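/- Let $\mathbb{K}=\mathbb{R}$ or $\mathbb{C}$. For $\mathbb{K}$-Banach spaces $E$, $F$, a mapping $Q\colon E\to F$ is a continuous $n$-homogeneous polynomial if $Q(x)=A(x,\dots,x)$ for some continuous $n$-linear mapping $A\colon E\times\cdots\times E\to F$. A sequence $(x_j)_{j=1}^\infty$ in $E$ is unconditionally $1$-summable if $\sum_j|\varphi(x_j)|<\infty$ for every $\varphi\in E'$ and $$\lim_{k\to\infty}\ \sup_{\varphi\in E',\,\|\varphi\|\le 1}\ \sum_{j\ge k}|\varphi(x_j)|=0 .$$ The $1$-summing set $S_1(Q)$ is the set of all $a\in E$ such that $\sum_j\|Q(a+x_j)-Q(a)\|<\infty$ for every unconditionally $1$-summable sequence $(x_j)_{j=1}^\infty$ in $E$. A set $A\subseteq E$ is lineable if $A\cup\{0\}$ contains an infinite-dimensional linear subspace of $E$. Let $n\ge 2$ be an integer. For every finite-dimensional subspace $G$ of $L_2([-\pi,\pi];\mathbb{K})$ there exists a continuous $n$-homogeneous polynomial $Q\colon L_2([-\pi,\pi];\mathbb{K})\to L_1([-\pi,\pi];\mathbb{K})$ such that $S_1(Q)=G$. In particular,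 there exists a continuous $n$-homogeneous polynomial $Q\colon L_2([-\pi,\pi];\mathbb{K})\to L_1([-\pi,\pi];\mathbb{K})$ whose summing set $S_1(Q)$ satisfies $S_1(Q)\neq\emptyset$, $S_1(Q)\neq\{0\}$ and is not lineable. -/

import Mathlib

open MeasureTheory Filter Topology
open scoped ENNReal

/-- `P : E → F` is a continuous `n`-homogeneous polynomial: the restriction to the diagonal of a
continuous `n`-linear mapping `E × ⋯ × E → F`. -/
def IsHomogeneousPolynomial (𝕜 : Type*) [RCLike 𝕜] {E F : Type*}
    [NormedAddCommGroup E] [NormedSpace 𝕜 E] [NormedAddCommGroup F] [NormedSpace 𝕜 F]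
    (n : ℕ) (P : E → F) : Prop :=
  ∃ A : ContinuousMultilinearMap 𝕜 (fun _ : Fin n => E) F, ∀ x : E, P x = A (fun _ => x)

/-- `(y j)` is absolutely `p`-summable, i.e. it belongs to `ℓ_p(F)`. -/
def AbsolutelySummable {F : Type*} [NormedAddCommGroup F] (p : ℝ) (y : ℕ → F) : Prop :=
  Summable fun j => ‖y j‖ ^ p

/-- `(x j)` is weakly `q`-summable, i.e. it belongs to `ℓ_q^w(E)`: the scalar sequence `(φ (x j))`
is in `ℓ_q` for every continuous linear functional `φ`. -/
def WeaklySummable (𝕜 : Type*) [RCLike 𝕜] {E : Type*} [NormedAddCommGroup E] [NormedSpace 𝕜 E]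
    (q : ℝ) (x : ℕ → E) : Prop :=
  ∀ φ : StrongDual 𝕜 E, AbsolutelySummable q fun j => φ (x j)

/-- The weak `ℓ_q` norm `sup {(∑ |φ (x j)| ^ q) ^ (1 / q) : ‖φ‖ ≤ 1}`, with values in `[0, ∞]`. -/
noncomputable def weakNorm (𝕜 : Type*) [RCLike 𝕜] {E : Type*}
    [NormedAddCommGroup E] [NormedSpace 𝕜 E] (q : ℝ) (x : ℕ → E) : ℝ≥0∞ :=
  ⨆ (φ : StrongDual 𝕜 E) (_ : ‖φ‖ ≤ 1), (∑' j, ‖φ (x j)‖ₑ ^ q) ^ (1 / q)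

/-- `(x j)` is unconditionally `q`-summable, i.e. it belongs to `ℓ_q^u(E)`: it is weakly
`q`-summable and the weak norms of its tails tend to `0`. -/
def UnconditionallySummable (𝕜 : Type*) [RCLike 𝕜] {E : Type*}
    [NormedAddCommGroup E] [NormedSpace 𝕜 E] (q : ℝ) (x : ℕ → E) : Prop :=
  WeaklySummable 𝕜 q x ∧ Tendsto (fun k => weakNorm 𝕜 q fun j => x (j + k)) atTop (𝓝 0)

/-- `f` is `(p; q)`-summing at the point `a`. -/
def IsSummingAt (𝕜 : Type*) [RCLike 𝕜] {E F : Type*}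
    [NormedAddCommGroup E] [NormedSpace 𝕜 E] [NormedAddCommGroup F]
    (p q : ℝ) (f : E → F) (a : E) : Prop :=
  ∀ x : ℕ → E, UnconditionallySummable 𝕜 q x → AbsolutelySummable p fun j => f (a + x j) - f a

/-- The `(p; q)`-summing set `S_{p;q}(f)`; `S_p(f)` is `summingSet 𝕜 p p f`. -/
def summingSet (𝕜 : Type*) [RCLike 𝕜] {E F : Type*}
    [NormedAddCommGroup E] [NormedSpace 𝕜 E] [NormedAddCommGroup F]
    (p q : ℝ) (f : E → F) : Set E :=
  {a | IsSummingAt 𝕜 p q f a}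

/-- `A` is lineable: `A ∪ {0}` contains an infinite-dimensional linear subspace. -/
def Lineable (𝕜 : Type*) [RCLike 𝕜] {E : Type*} [NormedAddCommGroup E] [NormedSpace 𝕜 E]
    (A : Set E) : Prop :=
  ∃ V : Submodule 𝕜 E, ¬ FiniteDimensional 𝕜 V ∧ (V : Set E) ⊆ A ∪ {0}

/-- The Banach space `L_p([-π, π]; 𝕜)` for Lebesgue measure. -/
abbrev LpInterval (𝕜 : Type*) [RCLike 𝕜] (p : ℝ≥0∞) : Type _ :=
  Lp 𝕜 p (volume.restrict (Set.Icc (-Real.pi) Real.pi))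

/-! Let `G` be a closed subspace of `L²` cut out by functionals `φₖ` in the unit ball, and put
`Q x = γ x * x` with `γ x = ∑ₖ (φₖ x) ^ (n - 1) • wₖ`, where the `wₖ` are orthogonal, nonzero and
absolutely summable, so that `γ` vanishes exactly on `G`.

If `a ∈ G`, then `γ (a + x) = γ x`, so the increments of `Q` at `a` are `γ (xⱼ) * (a + xⱼ)`, and
`∑ⱼ ‖γ (xⱼ)‖` is controlled by the sums `∑ⱼ |φₖ (xⱼ)|`, which are bounded uniformly in `k`.

If `a ∉ G`, then the derivative of `Q` at `a` is multiplication by `γ a ≠ 0` plus an operator that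
sends weakly null sequences to norm null ones. The Rademacher functions `vⱼ` are orthonormal and
have constant modulus, so `‖γ a * vⱼ‖₁` is a positive constant and the derivative stays bounded
away from zero along them. Hence the increments of `Q` at `a` along the unconditionally summable
sequence `vⱼ / (j + 1)` dominate a harmonic series. -/

section UnconditionallySummable

variable {𝕜 : Type*} [RCLike 𝕜] {E : Type*} [NormedAddCommGroup E] [NormedSpace 𝕜 E]

theorem UnconditionallySummable.exists_sum_norm_dual_le_one {x : ℕ → E}
    (hx : UnconditionallySummable 𝕜 1 x) :
    ∃ K, ∀ φ : StrongDual 𝕜 E, ‖φ‖ ≤ 1 → ∀ s : Finset ℕ, ∑ j ∈ s, ‖φ (x (j + K))‖ ≤ 1 := by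
  obtain ⟨K, hK⟩ := (hx.2.eventually (ge_mem_nhds (zero_lt_one' ℝ≥0∞))).exists
  refine ⟨K, fun φ hφ s => ?_⟩
  have hsum : ∑ j ∈ s, ‖φ (x (j + K))‖ₑ ≤ 1 := calc
    ∑ j ∈ s, ‖φ (x (j + K))‖ₑ ≤ (∑' j, ‖φ (x (j + K))‖ₑ ^ (1 : ℝ)) ^ (1 / (1 : ℝ)) := by
      simpa using ENNReal.sum_le_tsum s
    _ ≤ weakNorm 𝕜 1 fun j => x (j + K) :=
      le_iSup₂ (f := fun (φ : StrongDual 𝕜 E) (_ : ‖φ‖ ≤ 1) =>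
        (∑' j, ‖φ (x (j + K))‖ₑ ^ (1 : ℝ)) ^ (1 / (1 : ℝ))) φ hφ
    _ ≤ 1 := hK
  simpa [ENNReal.toReal_sum] using ENNReal.toReal_mono ENNReal.one_ne_top hsum

theorem UnconditionallySummable.eventually_norm_le_one {x : ℕ → E}
    (hx : UnconditionallySummable 𝕜 1 x) : ∀ᶠ j in atTop, ‖x j‖ ≤ 1 := by
  obtain ⟨K, hK⟩ := hx.exists_sum_norm_dual_le_one
  filter_upwards [eventually_ge_atTop K] with j hj
  obtain ⟨φ, hφ, hφx⟩ := exists_dual_vector'' 𝕜 (x j)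
  simpa [Nat.sub_add_cancel hj, hφx] using hK φ hφ {j - K}

end UnconditionallySummable

section Orthonormal

variable {𝕜 : Type*} [RCLike 𝕜] {H : Type*} [NormedAddCommGroup H] [InnerProductSpace 𝕜 H]
  [CompleteSpace H]

theorem tendsto_dual_of_orthonormal {v : ℕ → H} (hv : Orthonormal 𝕜 v) (φ : StrongDual 𝕜 H) :
    Tendsto (fun j => φ (v j)) atTop (𝓝 0) := by
  have hsq := (hv.inner_products_summable
    ((InnerProductSpace.toDual 𝕜 H).symm φ)).tendsto_atTop_zero.sqrt
  have hφ (j : ℕ) : ‖φ (v j)‖ = ‖inner 𝕜 (v j) ((InnerProductSpace.toDual 𝕜 H).symm φ)‖ := by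
    rw [norm_inner_symm, InnerProductSpace.toDual_symm_apply]
  rw [tendsto_zero_iff_norm_tendsto_zero]
  simpa [Real.sqrt_sq, hφ] using hsq

theorem sum_norm_dual_smul_le_of_orthonormal {ι : Type*} {v : ι → H} (hv : Orthonormal 𝕜 v)
    (l : ι → 𝕜) (φ : StrongDual 𝕜 H) (s : Finset ι) :
    ∑ i ∈ s, ‖φ (l i • v i)‖ ≤ √(∑ i ∈ s, ‖l i‖ ^ 2) * ‖φ‖ := by
  set z := (InnerProductSpace.toDual 𝕜 H).symm φ with hz
  have hφz (i : ι) : ‖φ (v i)‖ = ‖inner 𝕜 (v i) z‖ := by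
    rw [norm_inner_symm, hz, InnerProductSpace.toDual_symm_apply]
  calc ∑ i ∈ s, ‖φ (l i • v i)‖ = ∑ i ∈ s, ‖l i‖ * ‖inner 𝕜 (v i) z‖ := by
        simp only [map_smul, norm_smul, hφz]
    _ ≤ √(∑ i ∈ s, ‖l i‖ ^ 2) * √(∑ i ∈ s, ‖inner 𝕜 (v i) z‖ ^ 2) :=
        Real.sum_mul_le_sqrt_mul_sqrt s _ _
    _ ≤ √(∑ i ∈ s, ‖l i‖ ^ 2) * √(‖z‖ ^ 2) := by
        gcongr
        exact hv.sum_inner_products_le z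
    _ = √(∑ i ∈ s, ‖l i‖ ^ 2) * ‖φ‖ := by
        rw [Real.sqrt_sq (norm_nonneg z), hz, LinearIsometryEquiv.norm_map]

theorem weakNorm_smul_le_of_orthonormal {v : ℕ → H} (hv : Orthonormal 𝕜 v) {l : ℕ → 𝕜}
    (hl : Summable fun i => ‖l i‖ ^ 2) :
    weakNorm 𝕜 1 (fun i => l i • v i) ≤ ENNReal.ofReal √(∑' i, ‖l i‖ ^ 2) := by
  refine iSup₂_le fun φ hφ => ?_
  simp only [ENNReal.rpow_one, div_one]
  rw [ENNReal.tsum_eq_iSup_sum]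
  refine iSup_le fun s => ?_
  simp only [← ofReal_norm]
  rw [← ENNReal.ofReal_sum_of_nonneg fun _ _ => norm_nonneg _]
  refine ENNReal.ofReal_le_ofReal ?_
  calc ∑ i ∈ s, ‖φ (l i • v i)‖ ≤ √(∑ i ∈ s, ‖l i‖ ^ 2) * ‖φ‖ :=
        sum_norm_dual_smul_le_of_orthonormal hv l φ s
    _ ≤ √(∑ i ∈ s, ‖l i‖ ^ 2) := mul_le_of_le_one_right (Real.sqrt_nonneg _) hφ
    _ ≤ √(∑' i, ‖l i‖ ^ 2) := Real.sqrt_le_sqrt (hl.sum_le_tsum s fun _ _ => by positivity)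

theorem unconditionallySummable_smul_of_orthonormal {v : ℕ → H} (hv : Orthonormal 𝕜 v)
    {l : ℕ → 𝕜} (hl : Summable fun i => ‖l i‖ ^ 2) :
    UnconditionallySummable 𝕜 1 fun i => l i • v i := by
  refine ⟨fun φ => ?_, ?_⟩
  · simp only [AbsolutelySummable, Real.rpow_one]
    refine summable_of_sum_le (c := √(∑' i, ‖l i‖ ^ 2) * ‖φ‖) (fun _ => norm_nonneg _) fun s =>
      (sum_norm_dual_smul_le_of_orthonormal hv l φ s).trans ?_
    gcongr
    exact hl.sum_le_tsum s fun _ _ => by positivity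
  · have htail : Tendsto (fun k => ENNReal.ofReal √(∑' j, ‖l (j + k)‖ ^ 2)) atTop (𝓝 0) := by
      simpa using ENNReal.tendsto_ofReal (tendsto_sum_nat_add fun i => ‖l i‖ ^ 2).sqrt
    exact tendsto_of_tendsto_of_tendsto_of_le_of_le tendsto_const_nhds htail
      (fun _ => zero_le) fun k => weakNorm_smul_le_of_orthonormal
        (hv.comp _ (add_left_injective k)) ((summable_nat_add_iff k).2 hl)

theorem not_isSummingAt_of_hasFDerivAt {F : Type*} [NormedAddCommGroup F] [NormedSpace 𝕜 F]
    {f : H → F} {f' : H →L[𝕜] F} {a : H} (hf : HasFDerivAt f f' a) {v : ℕ → H}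
    (hv : Orthonormal 𝕜 v) {c : ℝ} (hc : 0 < c) (hf' : ∀ᶠ j in atTop, c ≤ ‖f' (v j)‖) :
    ¬ IsSummingAt 𝕜 1 1 f a := by
  intro hsumming
  let l : ℕ → 𝕜 := fun j => ((j : 𝕜) + 1)⁻¹
  have hl (j : ℕ) : ‖l j‖ = ((j : ℝ) + 1)⁻¹ := by
    rw [norm_inv, ← Nat.cast_succ, RCLike.norm_natCast, Nat.cast_succ]
  have hnorm (j : ℕ) : ‖l j • v j‖ = ‖l j‖ := by rw [norm_smul, hv.1, mul_one]
  have hl_sq : Summable fun j => ‖l j‖ ^ 2 := by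
    simpa [hl] using (summable_nat_add_iff 1).2 (Real.summable_nat_pow_inv.2 one_lt_two)
  have hl_zero : Tendsto (fun j => l j • v j) atTop (𝓝 0) := by
    rw [tendsto_zero_iff_norm_tendsto_zero]
    simpa [hnorm, hl] using tendsto_one_div_add_atTop_nhds_zero_nat (𝕜 := ℝ)
  have hincr : Summable fun j => ‖f (a + l j • v j) - f a‖ := by
    simpa [AbsolutelySummable] using
      hsumming _ (unconditionallySummable_smul_of_orthonormal hv hl_sq)
  have hremainder := ((hasFDerivAt_iff_isLittleO_nhds_zero.1 hf).comp_tendsto hl_zero).bound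
    (half_pos hc)
  have hlower : ∀ᶠ j in atTop, c / 2 * ‖l j‖ ≤ ‖f (a + l j • v j) - f a‖ := by
    filter_upwards [hf', hremainder] with j hj hr
    have hlinear : c * ‖l j‖ ≤ ‖f' (l j • v j)‖ := by
      rw [map_smul, norm_smul, mul_comm]
      gcongr
    have htriangle := norm_sub_norm_le (f' (l j • v j)) (f (a + l j • v j) - f a)
    rw [norm_sub_rev (f' (l j • v j))] at htriangle
    simp only [Function.comp_apply, hnorm] at hr
    linarith
  have hharmonic : Summable fun j => c / 2 * ‖l j‖ := by
    refine hincr.of_norm_bounded_eventually_nat ?_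
    filter_upwards [hlower] with j hj
    rwa [Real.norm_of_nonneg (by positivity)]
  rw [summable_mul_left_iff (half_pos hc).ne'] at hharmonic
  refine Real.not_summable_natCast_inv ((summable_nat_add_iff 1).1 ?_)
  simpa [hl] using hharmonic

end Orthonormal

section DiagonalMultilinear

variable {𝕜 : Type*} [NontriviallyNormedField 𝕜] {E : Type*} [NormedAddCommGroup E]
  [NormedSpace 𝕜 E] {Z : Type*} [NormedAddCommGroup Z] [NormedSpace 𝕜 Z] {κ : Type*}

/-- The `m`-linear map `(x₁, …, xₘ) ↦ (φ x₁ ⋯ φ xₘ) • w`. -/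
noncomputable def rankOneMultilinear (m : ℕ) (φ : StrongDual 𝕜 E) (w : Z) :
    ContinuousMultilinearMap 𝕜 (fun _ : Fin m => E) Z :=
  ((ContinuousMultilinearMap.mkPiAlgebra 𝕜 (Fin m) 𝕜).compContinuousLinearMap
    fun _ => φ).smulRight w

theorem rankOneMultilinear_apply (m : ℕ) (φ : StrongDual 𝕜 E) (w : Z) (x : Fin m → E) :
    rankOneMultilinear m φ w x = (∏ i, φ (x i)) • w := by
  simp [rankOneMultilinear, ContinuousMultilinearMap.smulRight_apply]

theorem norm_rankOneMultilinear_le (m : ℕ) {φ : StrongDual 𝕜 E} (hφ : ‖φ‖ ≤ 1) (w : Z) :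
    ‖rankOneMultilinear m φ w‖ ≤ ‖w‖ := by
  refine ContinuousMultilinearMap.opNorm_le_bound (norm_nonneg w) fun x => ?_
  rw [rankOneMultilinear_apply, norm_smul, norm_prod, mul_comm]
  gcongr with i
  exact φ.le_of_opNorm_le_of_le hφ le_rfl |>.trans_eq (one_mul _)

theorem tendsto_rankOneMultilinear_update {α : Type*} {p : Filter α} {m : ℕ}
    {φ : StrongDual 𝕜 E} (w : Z) (z : Fin m → E) (i : Fin m) {y : α → E}
    (hy : Tendsto (fun j => φ (y j)) p (𝓝 0)) :
    Tendsto (fun j => rankOneMultilinear m φ w (Function.update z i (y j))) p (𝓝 0) := by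
  have hprod (j : α) : ∏ l, φ (Function.update z i (y j) l) =
      φ (y j) * ∏ l ∈ Finset.univ \ {i}, φ (z l) := by
    simp only [Function.apply_update fun _ => φ]
    exact Finset.prod_update_of_mem (Finset.mem_univ i) _ _
  simp only [rankOneMultilinear_apply, hprod]
  simpa using (hy.mul_const _).smul_const w

/-- The `m`-linear map `(x₁, …, xₘ) ↦ ∑ₖ (φₖ x₁ ⋯ φₖ xₘ) • wₖ`. The series is taken in operator
norm, so the value is the junk `0` unless it converges there, as it does when the `φₖ` lie in the
unit ball and `∑ ‖wₖ‖ < ∞`. -/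
noncomputable def diagonalMultilinear (m : ℕ) (φ : κ → StrongDual 𝕜 E) (w : κ → Z) :
    ContinuousMultilinearMap 𝕜 (fun _ : Fin m => E) Z :=
  ∑' k, rankOneMultilinear m (φ k) (w k)

variable [CompleteSpace Z] {φ : κ → StrongDual 𝕜 E} {w : κ → Z} {m : ℕ}

theorem hasSum_diagonalMultilinear (hφ : ∀ k, ‖φ k‖ ≤ 1) (hw : Summable fun k => ‖w k‖)
    (x : Fin m → E) :
    HasSum (fun k => rankOneMultilinear m (φ k) (w k) x) (diagonalMultilinear m φ w x) :=
  ContinuousMultilinearMap.hasSum_eval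
    (Summable.of_norm_bounded hw fun k => norm_rankOneMultilinear_le m (hφ k) (w k)).hasSum x

theorem hasSum_diagonalMultilinear_diag (hφ : ∀ k, ‖φ k‖ ≤ 1) (hw : Summable fun k => ‖w k‖)
    (x : E) : HasSum (fun k => φ k x ^ m • w k) (diagonalMultilinear m φ w fun _ => x) := by
  simpa [rankOneMultilinear_apply] using hasSum_diagonalMultilinear hφ hw fun _ : Fin m => x

theorem diagonalMultilinear_diag_add (hφ : ∀ k, ‖φ k‖ ≤ 1) (hw : Summable fun k => ‖w k‖)
    {a : E} (ha : ∀ k, φ k a = 0) (x : E) :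
    (diagonalMultilinear m φ w fun _ => a + x) = diagonalMultilinear m φ w fun _ => x := by
  refine (hasSum_diagonalMultilinear_diag hφ hw (a + x)).unique ?_
  simpa [ha] using hasSum_diagonalMultilinear_diag hφ hw x

theorem diagonalMultilinear_diag_eq_zero (hφ : ∀ k, ‖φ k‖ ≤ 1) (hw : Summable fun k => ‖w k‖)
    (hm : m ≠ 0) {a : E} (ha : ∀ k, φ k a = 0) : (diagonalMultilinear m φ w fun _ => a) = 0 := by
  simpa [ha, hm] using (hasSum_diagonalMultilinear_diag (m := m) hφ hw a).tsum_eq.symm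

theorem tendsto_diagonalMultilinear_update {α : Type*} {p : Filter α} (hφ : ∀ k, ‖φ k‖ ≤ 1)
    (hw : Summable fun k => ‖w k‖) (z : Fin m → E) (i : Fin m) {y : α → E} {C : ℝ}
    (hC : ∀ j, ‖y j‖ ≤ C) (hy : ∀ k, Tendsto (fun j => φ k (y j)) p (𝓝 0)) :
    Tendsto (fun j => diagonalMultilinear m φ w (Function.update z i (y j))) p (𝓝 0) := by
  have hbound (j : α) : ‖Function.update z i (y j)‖ ≤ max C ‖z‖ := by
    refine (pi_norm_le_iff_of_nonneg (le_max_of_le_right (norm_nonneg z))).2 fun l => ?_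
    rcases eq_or_ne l i with rfl | hl
    · simpa using Or.inl (hC j)
    · simpa [hl] using Or.inr (norm_le_pi_norm z l)
  simp only [← (hasSum_diagonalMultilinear hφ hw _).tsum_eq]
  rw [← tsum_zero (β := κ)]
  refine tendsto_tsum_of_dominated_convergence (hw.mul_right (max C ‖z‖ ^ m))
    (fun k => tendsto_rankOneMultilinear_update (w k) z i (hy k)) (.of_forall fun j k => ?_)
  refine (ContinuousMultilinearMap.le_opNorm_mul_pow_of_le _ (hbound j)).trans ?_
  gcongr
  exact norm_rankOneMultilinear_le m (hφ k) (w k)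

theorem sum_norm_diagonalMultilinear_diag_le (hφ : ∀ k, ‖φ k‖ ≤ 1)
    (hw : Summable fun k => ‖w k‖) (hm : m ≠ 0) {ι : Type*} {s : Finset ι} {x : ι → E}
    (hx : ∀ k, ∑ j ∈ s, ‖φ k (x j)‖ ≤ 1) :
    ∑ j ∈ s, ‖diagonalMultilinear m φ w fun _ => x j‖ ≤ ∑' k, ‖w k‖ := by
  have hpow (k : κ) : ∑ j ∈ s, ‖φ k (x j)‖ ^ m ≤ 1 := by
    refine (Finset.sum_le_sum fun j hj => ?_).trans (hx k)
    exact pow_le_of_le_one (norm_nonneg _) ((Finset.single_le_sum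
      (f := fun j => ‖φ k (x j)‖) (fun _ _ => norm_nonneg _) hj).trans (hx k)) hm
  have hterm (j : ι) (hj : j ∈ s) : Summable fun k => ‖φ k (x j)‖ ^ m * ‖w k‖ := by
    refine hw.of_nonneg_of_le (fun _ => by positivity) fun k => ?_
    refine mul_le_of_le_one_left (norm_nonneg _) ((Finset.single_le_sum
      (f := fun j => ‖φ k (x j)‖ ^ m) (fun _ _ => by positivity) hj).trans (hpow k))
  calc ∑ j ∈ s, ‖diagonalMultilinear m φ w fun _ => x j‖
      ≤ ∑ j ∈ s, ∑' k, ‖φ k (x j)‖ ^ m * ‖w k‖ := by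
        refine Finset.sum_le_sum fun j hj => ?_
        exact (hasSum_diagonalMultilinear_diag hφ hw (x j)).norm_le_of_bounded
          (hterm j hj).hasSum fun k => by rw [norm_smul, norm_pow]
    _ = ∑' k, (∑ j ∈ s, ‖φ k (x j)‖ ^ m) * ‖w k‖ := by
        simp only [Finset.sum_mul, Summable.tsum_finsetSum hterm]
    _ ≤ ∑' k, ‖w k‖ := by
        have hle (k : κ) : (∑ j ∈ s, ‖φ k (x j)‖ ^ m) * ‖w k‖ ≤ ‖w k‖ :=
          mul_le_of_le_one_left (norm_nonneg _) (hpow k)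
        exact (hw.of_nonneg_of_le (fun _ => by positivity) hle).tsum_le_tsum hle hw

end DiagonalMultilinear

theorem UnconditionallySummable.summable_norm_diagonalMultilinear_diag {𝕜 : Type*} [RCLike 𝕜]
    {E : Type*} [NormedAddCommGroup E] [NormedSpace 𝕜 E] {Z : Type*} [NormedAddCommGroup Z]
    [NormedSpace 𝕜 Z] [CompleteSpace Z] {κ : Type*} {φ : κ → StrongDual 𝕜 E}
    {w : κ → Z} {m : ℕ}
    (hφ : ∀ k, ‖φ k‖ ≤ 1) (hw : Summable fun k => ‖w k‖) (hm : m ≠ 0) {x : ℕ → E}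
    (hx : UnconditionallySummable 𝕜 1 x) :
    Summable fun j => ‖diagonalMultilinear m φ w fun _ => x j‖ := by
  obtain ⟨K, hK⟩ := hx.exists_sum_norm_dual_le_one
  rw [← summable_nat_add_iff K]
  exact summable_of_sum_le (fun _ => norm_nonneg _) fun s =>
    sum_norm_diagonalMultilinear_diag_le hφ hw hm fun k => hK (φ k) (hφ k) s

theorem forall_eq_zero_of_diagonalMultilinear_diag_eq_zero {𝕜 : Type*} [RCLike 𝕜] {E : Type*}
    [NormedAddCommGroup E] [NormedSpace 𝕜 E] {Z : Type*} [NormedAddCommGroup Z]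
    [InnerProductSpace 𝕜 Z] [CompleteSpace Z] {κ : Type*} {φ : κ → StrongDual 𝕜 E}
    {w : κ → Z} {m : ℕ}
    (hφ : ∀ k, ‖φ k‖ ≤ 1) (hw : Summable fun k => ‖w k‖) (hw_ne : ∀ k, w k ≠ 0)
    (hw_orth : Pairwise fun i j => inner 𝕜 (w i) (w j) = 0) {x : E}
    (hx : (diagonalMultilinear m φ w fun _ => x) = 0) (k : κ) : φ k x = 0 := by
  have hcoord : inner 𝕜 (w k) (diagonalMultilinear m φ w fun _ => x) =
      φ k x ^ m * inner 𝕜 (w k) (w k) := by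
    rw [← inner_smul_right]
    refine ((hasSum_diagonalMultilinear_diag hφ hw x).mapL (innerSL 𝕜 (w k))).unique ?_
    refine hasSum_single k fun i hi => ?_
    rw [innerSL_apply_apply, inner_smul_right, hw_orth hi.symm, mul_zero]
  rw [hx, inner_zero_right, eq_comm, mul_eq_zero] at hcoord
  exact eq_zero_of_pow_eq_zero (hcoord.resolve_right (inner_self_ne_zero.2 (hw_ne k)))

section DiagonalPolynomial

variable {𝕜 : Type*} [RCLike 𝕜] {E : Type*} [NormedAddCommGroup E] [NormedSpace 𝕜 E]
  {Z : Type*} [NormedAddCommGroup Z] [NormedSpace 𝕜 Z] {F : Type*} [NormedAddCommGroup F]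
  [NormedSpace 𝕜 F] {κ : Type*}

/-- The `(m + 1)`-homogeneous polynomial `x ↦ B (∑ₖ (φₖ x) ^ m • wₖ) x`. -/
noncomputable def diagonalPolynomial (B : Z →L[𝕜] E →L[𝕜] F) (φ : κ → StrongDual 𝕜 E)
    (w : κ → Z) (m : ℕ) (x : E) : F :=
  B (diagonalMultilinear m φ w fun _ => x) x

theorem isHomogeneousPolynomial_diagonalPolynomial (B : Z →L[𝕜] E →L[𝕜] F)
    (φ : κ → StrongDual 𝕜 E) (w : κ → Z) (m : ℕ) :
    IsHomogeneousPolynomial 𝕜 (m + 1) (diagonalPolynomial B φ w m) :=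
  ⟨ContinuousMultilinearMap.uncurryRight (Ei := fun _ => E)
    (B.compContinuousMultilinearMap (diagonalMultilinear m φ w)), fun _ => rfl⟩

theorem hasFDerivAt_diagonalPolynomial (B : Z →L[𝕜] E →L[𝕜] F) (φ : κ → StrongDual 𝕜 E)
    (w : κ → Z) (m : ℕ) (a : E) :
    HasFDerivAt (diagonalPolynomial B φ w m)
      (B (diagonalMultilinear m φ w fun _ => a) + B.flip a ∘L
        (diagonalMultilinear m φ w).linearDeriv (fun _ => a) ∘L
          ContinuousLinearMap.pi fun _ => .id 𝕜 E) a := by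
  have hdiag := ((diagonalMultilinear m φ w).hasFDerivAt fun _ => a).comp a
    (ContinuousLinearMap.pi fun _ : Fin m => .id 𝕜 E).hasFDerivAt
  exact (B.hasFDerivAt.comp a hdiag).clm_apply (hasFDerivAt_id a)

variable [CompleteSpace Z] {φ : κ → StrongDual 𝕜 E} {w : κ → Z} {m : ℕ}

theorem isSummingAt_diagonalPolynomial (B : Z →L[𝕜] E →L[𝕜] F) (hφ : ∀ k, ‖φ k‖ ≤ 1)
    (hw : Summable fun k => ‖w k‖) (hm : m ≠ 0) {a : E} (ha : ∀ k, φ k a = 0) :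
    IsSummingAt 𝕜 1 1 (diagonalPolynomial B φ w m) a := by
  intro x hx
  simp only [AbsolutelySummable, Real.rpow_one]
  refine Summable.of_norm_bounded_eventually_nat
    ((hx.summable_norm_diagonalMultilinear_diag hφ hw hm).mul_left (‖B‖ * (‖a‖ + 1))) ?_
  filter_upwards [hx.eventually_norm_le_one] with j hj
  have hincr : diagonalPolynomial B φ w m (a + x j) - diagonalPolynomial B φ w m a =
      B (diagonalMultilinear m φ w fun _ => x j) (a + x j) := by
    simp only [diagonalPolynomial, diagonalMultilinear_diag_add hφ hw ha,
      diagonalMultilinear_diag_eq_zero hφ hw hm ha, map_zero, zero_apply, sub_zero]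
  rw [norm_norm, hincr]
  calc ‖B (diagonalMultilinear m φ w fun _ => x j) (a + x j)‖
      ≤ ‖B‖ * ‖diagonalMultilinear m φ w fun _ => x j‖ * ‖a + x j‖ := B.le_opNorm₂ _ _
    _ ≤ ‖B‖ * ‖diagonalMultilinear m φ w fun _ => x j‖ * (‖a‖ + 1) := by
        gcongr
        exact (norm_add_le _ _).trans (by gcongr)
    _ = ‖B‖ * (‖a‖ + 1) * ‖diagonalMultilinear m φ w fun _ => x j‖ := by ring

theorem not_isSummingAt_diagonalPolynomial {H : Type*} [NormedAddCommGroup H]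
    [InnerProductSpace 𝕜 H] [CompleteSpace H] {B : Z →L[𝕜] H →L[𝕜] F}
    {φ : κ → StrongDual 𝕜 H} (hφ : ∀ k, ‖φ k‖ ≤ 1) (hw : Summable fun k => ‖w k‖)
    {v : ℕ → H} (hv : Orthonormal 𝕜 v) {a : H} {c : ℝ} (hc : 0 < c)
    (hB : ∀ᶠ j in atTop, c ≤ ‖B (diagonalMultilinear m φ w fun _ => a) (v j)‖) :
    ¬ IsSummingAt 𝕜 1 1 (diagonalPolynomial B φ w m) a := by
  refine not_isSummingAt_of_hasFDerivAt (hasFDerivAt_diagonalPolynomial B φ w m a) hv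
    (half_pos hc) ?_
  set D := (diagonalMultilinear m φ w).linearDeriv (fun _ => a) ∘L
    ContinuousLinearMap.pi fun _ => .id 𝕜 H with hD
  have hD_zero : Tendsto (fun j => D (v j)) atTop (𝓝 0) := by
    simp only [hD, ContinuousLinearMap.comp_apply, ContinuousMultilinearMap.linearDeriv_apply]
    rw [← Finset.sum_const_zero (ι := Fin m) (s := Finset.univ)]
    exact tendsto_finsetSum _ fun i _ => tendsto_diagonalMultilinear_update hφ hw _ i
      (fun j => (hv.1 j).le) fun k => tendsto_dual_of_orthonormal hv (φ k)
  have herror : Tendsto (fun j => ‖B.flip a (D (v j))‖) atTop (𝓝 0) := by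
    simpa using (((B.flip a).continuous.tendsto 0).comp hD_zero).norm
  filter_upwards [hB, herror.eventually (ge_mem_nhds (half_pos hc))] with j hj hjerror
  have htriangle := norm_sub_le_norm_add (B (diagonalMultilinear m φ w fun _ => a) (v j))
    (B.flip a (D (v j)))
  rw [add_apply, ContinuousLinearMap.comp_apply]
  linarith

end DiagonalPolynomial

section ClosedSubspace

variable {𝕜 : Type*} [RCLike 𝕜] {H : Type*} [NormedAddCommGroup H] [InnerProductSpace 𝕜 H]
  [CompleteSpace H] [TopologicalSpace.SeparableSpace H]

theorem exists_dual_seq_forall_eq_zero_iff_mem {G : Submodule 𝕜 H} (hG : IsClosed (G : Set H)) :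
    ∃ φ : ℕ → StrongDual 𝕜 H, (∀ k, ‖φ k‖ ≤ 1) ∧ ∀ x, (∀ k, φ k x = 0) ↔ x ∈ G := by
  let d := TopologicalSpace.denseSeq Gᗮ
  refine ⟨fun k => (‖d k‖ : 𝕜)⁻¹ • innerSL 𝕜 (d k : H), fun k => ?_, fun x => ?_⟩
  · rw [norm_smul, innerSL_apply_norm, norm_inv, RCLike.norm_ofReal, abs_norm]
    exact inv_mul_le_one
  · have hker (k : ℕ) : ((‖d k‖ : 𝕜)⁻¹ • innerSL 𝕜 (d k : H)) x = 0 ↔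
        inner 𝕜 (d k : H) x = 0 := by
      rw [smul_apply, innerSL_apply_apply, smul_eq_mul, mul_eq_zero,
        inv_eq_zero, RCLike.ofReal_eq_zero, norm_eq_zero, or_iff_right_iff_imp]
      intro hk
      simp [hk]
    have hclosed : IsClosed {y : Gᗮ | inner 𝕜 (y : H) x = 0} :=
      isClosed_eq (by fun_prop) continuous_const
    have hmem : x ∈ G ↔ ∀ y ∈ Gᗮ, inner 𝕜 y x = 0 := by
      rw [← Submodule.mem_orthogonal, Submodule.orthogonal_orthogonal_eq_closure,
        hG.submodule_topologicalClosure_eq]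
    rw [hmem]
    simp only [hker]
    exact ⟨fun hx y hy => (TopologicalSpace.denseRange_denseSeq Gᗮ).induction_on
      (p := fun z : Gᗮ => inner 𝕜 (z : H) x = 0) ⟨y, hy⟩ hclosed hx,
      fun hx k => hx _ (d k).2⟩

theorem exists_homogeneousPolynomial_summingSet_eq {F : Type*} [NormedAddCommGroup F]
    [NormedSpace 𝕜 F] {v : ℕ → H} (hv : Orthonormal 𝕜 v) (B : H →L[𝕜] H →L[𝕜] F)
    (hB : ∀ b : H, b ≠ 0 → ∃ c > 0, ∀ᶠ j in atTop, c ≤ ‖B b (v j)‖) {n : ℕ} (hn : 2 ≤ n)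
    {G : Submodule 𝕜 H} (hG : IsClosed (G : Set H)) :
    ∃ Q : H → F, IsHomogeneousPolynomial 𝕜 n Q ∧ summingSet 𝕜 1 1 Q = (G : Set H) := by
  obtain ⟨m, rfl⟩ : ∃ m, n = m + 1 := Nat.exists_eq_add_of_le' (by lia)
  obtain ⟨φ, hφ, hφG⟩ := exists_dual_seq_forall_eq_zero_iff_mem hG
  let w : ℕ → H := fun k => ((1 / 2 : ℝ) ^ k : 𝕜) • v k
  have hw : Summable fun k => ‖w k‖ := by
    simpa [w, norm_smul, hv.1] using summable_geometric_two
  have hw_ne (k : ℕ) : w k ≠ 0 := smul_ne_zero (by simp) (hv.ne_zero k)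
  have hw_orth : Pairwise fun i j => inner 𝕜 (w i) (w j) = 0 := fun i j hij => by
    simp [w, inner_smul_left, inner_smul_right, hv.2 hij]
  refine ⟨diagonalPolynomial B φ w m, isHomogeneousPolynomial_diagonalPolynomial B φ w m,
    Set.ext fun a => ⟨fun ha => ?_, fun ha =>
      isSummingAt_diagonalPolynomial B hφ hw (by lia) ((hφG a).2 ha)⟩⟩
  by_contra haG
  have hne : (diagonalMultilinear m φ w fun _ => a) ≠ 0 := fun h => haG <|
    (hφG a).1 (forall_eq_zero_of_diagonalMultilinear_diag_eq_zero hφ hw hw_ne hw_orth h)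
  obtain ⟨c, hc, hcB⟩ := hB _ hne
  exact not_isSummingAt_diagonalPolynomial hφ hw hv hc hcB ha

end ClosedSubspace

theorem lineable_coe_iff {𝕜 : Type*} [RCLike 𝕜] {E : Type*} [NormedAddCommGroup E]
    [NormedSpace 𝕜 E] {G : Submodule 𝕜 E} :
    Lineable 𝕜 (G : Set E) ↔ ¬ FiniteDimensional 𝕜 G := by
  refine ⟨fun ⟨V, hV, hVG⟩ hG => hV ?_, fun hG => ⟨G, hG, Set.subset_union_left⟩⟩
  rw [Set.union_eq_left.2 (Set.singleton_subset_iff.2 G.zero_mem)] at hVG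
  exact Submodule.finiteDimensional_of_le hVG

theorem intervalIntegral_eq_zero_of_antiperiodic {E : Type*} [NormedAddCommGroup E]
    [NormedSpace ℝ E] {f : ℝ → E} {c T : ℝ} (hc : Function.Antiperiodic f c)
    (hT : Function.Periodic f T) (a : ℝ) : ∫ t in a..a + T, f t = 0 := by
  have : IsAddTorsionFree E := .of_isTorsionFree ℝ E
  rw [← self_eq_neg]
  calc ∫ t in a..a + T, f t = ∫ t in a + c..a + c + T, f t := hT.intervalIntegral_add_eq _ _
    _ = ∫ t in a..a + T, f (t + c) := by
      rw [intervalIntegral.integral_comp_add_right, add_right_comm]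
    _ = -∫ t in a..a + T, f t := by simp only [hc _, intervalIntegral.integral_neg]

section Rademacher

variable (𝕜 : Type*) [RCLike 𝕜]

/-- The `j`-th Rademacher function on `[-π, π]`, normalised in `L²`. It is a sign times
`1 / √(2π)` at every point, and changes sign at the multiples of `π / 2 ^ j`. -/
noncomputable def rademacher (j : ℕ) (t : ℝ) : 𝕜 :=
  (-1) ^ ⌊t / (Real.pi / 2 ^ j)⌋ * ((√(2 * Real.pi))⁻¹ : ℝ)

theorem norm_rademacher (j : ℕ) (t : ℝ) : ‖rademacher 𝕜 j t‖ = (√(2 * Real.pi))⁻¹ := by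
  rw [rademacher, norm_mul, norm_zpow, norm_neg, norm_one, one_zpow, one_mul,
    RCLike.norm_of_nonneg (by positivity)]

theorem measurable_rademacher (j : ℕ) : Measurable (rademacher 𝕜 j) :=
  ((measurable_of_countable fun k : ℤ => ((-1 : 𝕜) ^ k)).comp
    (measurable_id.div_const _).floor).mul_const _

theorem antiperiodic_rademacher (j : ℕ) :
    Function.Antiperiodic (rademacher 𝕜 j) (Real.pi / 2 ^ j) := fun t => by
  have hpos : Real.pi / 2 ^ j ≠ 0 := by positivity
  rw [rademacher, rademacher, add_div, div_self hpos, Int.floor_add_one,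
    zpow_add_one₀ (by simp), mul_neg_one, neg_mul]

theorem periodic_rademacher {i j : ℕ} (hij : i < j) :
    Function.Periodic (rademacher 𝕜 j) (Real.pi / 2 ^ i) := by
  obtain ⟨k, rfl⟩ := Nat.exists_eq_add_of_lt hij
  convert! (antiperiodic_rademacher 𝕜 (i + k + 1)).nat_even_mul_periodic (2 ^ k) using 1
  push_cast
  field_simp
  ring

theorem periodic_two_pi_rademacher (j : ℕ) :
    Function.Periodic (rademacher 𝕜 j) (2 * Real.pi) := by
  convert! (antiperiodic_rademacher 𝕜 j).nat_even_mul_periodic (2 ^ j) using 1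
  push_cast
  field_simp

theorem integral_inner_rademacher_of_lt {i j : ℕ} (hij : i < j) :
    ∫ t in Set.Icc (-Real.pi) Real.pi, inner 𝕜 (rademacher 𝕜 i t) (rademacher 𝕜 j t) = 0 := by
  have hanti : Function.Antiperiodic
      (fun t => inner 𝕜 (rademacher 𝕜 i t) (rademacher 𝕜 j t)) (Real.pi / 2 ^ i) := fun t => by
    simp only [antiperiodic_rademacher 𝕜 i t, periodic_rademacher 𝕜 hij t, inner_neg_left]
  have hper : Function.Periodic
      (fun t => inner 𝕜 (rademacher 𝕜 i t) (rademacher 𝕜 j t)) (2 * Real.pi) := fun t => by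
    simp only [periodic_two_pi_rademacher 𝕜 _ t]
  rw [integral_Icc_eq_integral_Ioc,
    ← intervalIntegral.integral_of_le (by linarith [Real.pi_pos]),
    ← intervalIntegral_eq_zero_of_antiperiodic hanti hper (-Real.pi)]
  congr 1
  ring

theorem memLp_rademacher (j : ℕ) (p : ℝ≥0∞) :
    MemLp (rademacher 𝕜 j) p (volume.restrict (Set.Icc (-Real.pi) Real.pi)) :=
  .of_bound (measurable_rademacher 𝕜 j).aestronglyMeasurable _
    (.of_forall fun t => (norm_rademacher 𝕜 j t).le)

/-- The normalised Rademacher functions as elements of `L²([-π, π])`. -/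
noncomputable def rademacherLp (j : ℕ) : LpInterval 𝕜 2 := (memLp_rademacher 𝕜 j 2).toLp

theorem inner_rademacherLp (i j : ℕ) :
    inner 𝕜 (rademacherLp 𝕜 i) (rademacherLp 𝕜 j) =
      ∫ t in Set.Icc (-Real.pi) Real.pi, inner 𝕜 (rademacher 𝕜 i t) (rademacher 𝕜 j t) := by
  rw [L2.inner_def]
  refine integral_congr_ae ?_
  filter_upwards [(memLp_rademacher 𝕜 i 2).coeFn_toLp, (memLp_rademacher 𝕜 j 2).coeFn_toLp]
    with t hi hj
  rw [rademacherLp, rademacherLp, hi, hj]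

theorem orthonormal_rademacherLp : Orthonormal 𝕜 (rademacherLp 𝕜) := by
  refine ⟨fun j => ?_, fun i j hij => ?_⟩
  · have hsq : inner 𝕜 (rademacherLp 𝕜 j) (rademacherLp 𝕜 j) = 1 := by
      have hpi : (0 : ℝ) ≤ 2 * Real.pi := by positivity
      have hvol : Real.pi - -Real.pi = 2 * Real.pi := by ring
      rw [inner_rademacherLp]
      simp only [inner_self_eq_norm_sq_to_K, norm_rademacher]
      rw [setIntegral_const, Real.volume_real_Icc_of_le (by linarith), hvol, ← RCLike.ofReal_pow,
        RCLike.real_smul_eq_coe_mul, ← RCLike.ofReal_mul, inv_pow, Real.sq_sqrt hpi,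
        mul_inv_cancel₀ (by positivity), RCLike.ofReal_one]
    rw [@norm_eq_sqrt_re_inner 𝕜, hsq, RCLike.one_re, Real.sqrt_one]
  · rcases hij.lt_or_gt with h | h
    · rw [inner_rademacherLp, integral_inner_rademacher_of_lt 𝕜 h]
    · rw [inner_eq_zero_symm, inner_rademacherLp, integral_inner_rademacher_of_lt 𝕜 h]

/-- The pointwise product `L²([-π, π]) × L²([-π, π]) → L¹([-π, π])`. -/
noncomputable def lpMul : LpInterval 𝕜 2 →L[𝕜] LpInterval 𝕜 2 →L[𝕜] LpInterval 𝕜 1 :=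
  (ContinuousLinearMap.mul 𝕜 𝕜).holderL _ 2 2 1

theorem norm_lpMul_rademacherLp (b : LpInterval 𝕜 2) (j : ℕ) :
    ‖lpMul 𝕜 b (rademacherLp 𝕜 j)‖ =
      (∫ t in Set.Icc (-Real.pi) Real.pi, ‖b t‖) * (√(2 * Real.pi))⁻¹ := by
  rw [L1.norm_eq_integral_norm, ← integral_mul_const]
  refine integral_congr_ae ?_
  filter_upwards [ContinuousLinearMap.coeFn_holder (r := 1) (ContinuousLinearMap.mul 𝕜 𝕜) b
    (rademacherLp 𝕜 j), (memLp_rademacher 𝕜 j 2).coeFn_toLp] with t hmul hj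
  rw [← norm_rademacher 𝕜 j t, ← hj, ← norm_mul]
  exact congrArg norm hmul

theorem norm_lpMul_rademacherLp_pos {b : LpInterval 𝕜 2} (hb : b ≠ 0) (j : ℕ) :
    0 < ‖lpMul 𝕜 b (rademacherLp 𝕜 j)‖ := by
  have hint : Integrable b (volume.restrict (Set.Icc (-Real.pi) Real.pi)) :=
    (Lp.memLp b).integrable one_le_two
  have hpos : 0 < ∫ t in Set.Icc (-Real.pi) Real.pi, ‖b t‖ := by
    refine (integral_nonneg fun _ => norm_nonneg _).lt_of_ne' fun hzero => hb ?_
    rw [integral_eq_zero_iff_of_nonneg (fun _ => norm_nonneg _) hint.norm] at hzero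
    rw [Lp.eq_zero_iff_ae_eq_zero]
    filter_upwards [hzero] with t ht using norm_eq_zero.1 ht
  rw [norm_lpMul_rademacherLp]
  positivity

end Rademacher

theorem mainTheorem6_general (𝕜 : Type*) [RCLike 𝕜] (n : ℕ) (hn : 2 ≤ n) :
    (∀ G : Submodule 𝕜 (LpInterval 𝕜 2), IsClosed (G : Set (LpInterval 𝕜 2)) →
      ∃ Q : LpInterval 𝕜 2 → LpInterval 𝕜 1,
        IsHomogeneousPolynomial 𝕜 n Q ∧ summingSet 𝕜 1 1 Q = (G : Set (LpInterval 𝕜 2))) ∧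
    (∃ Q : LpInterval 𝕜 2 → LpInterval 𝕜 1,
      IsHomogeneousPolynomial 𝕜 n Q ∧ summingSet 𝕜 1 1 Q ≠ ∅ ∧ summingSet 𝕜 1 1 Q ≠ {0} ∧
        ¬ Lineable 𝕜 (summingSet 𝕜 1 1 Q)) := by
  -- needed for the separability of `L²`
  have : Fact ((2 : ℝ≥0∞) ≠ ∞) := ⟨ENNReal.ofNat_ne_top⟩
  have hclosed (G : Submodule 𝕜 (LpInterval 𝕜 2)) (hG : IsClosed (G : Set (LpInterval 𝕜 2))) :=
    exists_homogeneousPolynomial_summingSet_eq (orthonormal_rademacherLp 𝕜) (lpMul 𝕜)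
      (fun b hb => ⟨_, norm_lpMul_rademacherLp_pos 𝕜 hb 0, .of_forall fun j => by
        rw [norm_lpMul_rademacherLp, norm_lpMul_rademacherLp]⟩) hn hG
  refine ⟨hclosed, ?_⟩
  let line := Submodule.span 𝕜 {rademacherLp 𝕜 0}
  have hline : line ≠ ⊥ := by
    simpa [line] using (orthonormal_rademacherLp 𝕜).ne_zero 0
  obtain ⟨Q, hQ, hQline⟩ := hclosed line line.closed_of_finiteDimensional
  refine ⟨Q, hQ, ?_⟩
  rw [hQline, lineable_coe_iff, not_not]
  exact ⟨line.nonempty.ne_empty, by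
    rwa [Ne, ← Submodule.bot_coe (R := 𝕜), SetLike.coe_set_eq], inferInstance⟩

theorem mainTheorem6 (𝕜 : Type*) [RCLike 𝕜] (n : ℕ) (hn : 2 ≤ n) :
    (∀ G : Submodule 𝕜 (LpInterval 𝕜 2), FiniteDimensional 𝕜 G →
      ∃ Q : LpInterval 𝕜 2 → LpInterval 𝕜 1,
        IsHomogeneousPolynomial 𝕜 n Q ∧ summingSet 𝕜 1 1 Q = (G : Set (LpInterval 𝕜 2))) ∧
    (∃ Q : LpInterval 𝕜 2 → LpInterval 𝕜 1,
      IsHomogeneousPolynomial 𝕜 n Q ∧ summingSet 𝕜 1 1 Q ≠ ∅ ∧ summingSet 𝕜 1 1 Q ≠ {0} ∧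
        ¬ Lineable 𝕜 (summingSet 𝕜 1 1 Q)) :=
  ⟨fun G _ => (mainTheorem6_general 𝕜 n hn).1 G G.closed_of_finiteDimensional,
    (mainTheorem6_general 𝕜 n hn).2⟩
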